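/- Let $K_n=(V_n,E_n)$ be the complete graph on $n$ nodes, one of which is labelled $1$ (any choice of this node is allowed). For $S\subseteq V_n$ let $\delta(S)$ be the set of edges with exactly one end in $S$, and write $\delta(v)=\delta(\{v\})$ and $x(F)=\sum_{e\in F}x_e$. Let $S^n$ be the subtour elimination polytope, i.e. the set of all $x\in\mathbb{R}^{E_n}$ with $x(\delta(v))=2$ for all $v\in V_n$, $x(\delta(S))\ge 2$ for all $\emptyset\ne S\subsetneq V_n$, and $0\le x_e\le 1$ for all $e\in E_n$. A $1$-tree is a set $F\subseteq E_n$ such that $|F\cap\delta(1)|=2$ and $F\setminus\delta(1)$ forms a spanning tree on $V_n\setminus\{1\}$. Let $x\in S^n$ be $\frac12$-integer, i.e. $x_e\in\{0,\frac12,1\}$ for all $e\in E_n$, and let $\mathcal{P}$ be any partition of the set $\{e\in E_n : x_e=\frac12\}$ of $\frac12$-edges into pairs. Then $x$ is in the convex hull of the incidence vectors of those $1$-trees that contain exactly one edge from each pair in $\mathcal{P}$. -/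

import Mathlib

namespace RainbowOneTree

/-- The edge set of the complete graph on the node set `V`, as a type: the unordered pairs of
distinct nodes. Vectors indexed by the edges are functions `Edge V → ℝ`. -/
abbrev Edge (V : Type*) : Type _ := (⊤ : SimpleGraph V).edgeSet

variable {V : Type*} [Fintype V] [DecidableEq V]

open Classical in
/-- The cut `δ(S)`: the edges of the complete graph with one end in `S` and the other one
outside `S`. -/
noncomputable def cut (S : Finset V) : Finset (Edge V) :=
  {e : Edge V | ∃ u ∈ S, ∃ v ∉ S, e.1 = s(u, v)}

/-- The subtour elimination polytope of the complete graph on `V`. -/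
def subtourPolytope (V : Type*) [Fintype V] [DecidableEq V] : Set (Edge V → ℝ) :=
  {x | (∀ v : V, ∑ e ∈ cut {v}, x e = 2) ∧
    (∀ S : Finset V, S ≠ ∅ → S ≠ Finset.univ → 2 ≤ ∑ e ∈ cut S, x e) ∧
    ∀ e : Edge V, 0 ≤ x e ∧ x e ≤ 1}

/-- All coordinates of `x` are `0`, `1/2` or `1`. -/
def IsHalfInteger (x : Edge V → ℝ) : Prop :=
  ∀ e : Edge V, x e = 0 ∨ x e = 1 / 2 ∨ x e = 1

open Classical in
/-- The set of `1/2`-edges of `x`. -/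
noncomputable def halfEdges (x : Edge V → ℝ) : Finset (Edge V) :=
  {e : Edge V | x e = 1 / 2}

/-- The graph `(V, F)` of a set `F` of edges of the complete graph. -/
def graphOf (F : Finset (Edge V)) : SimpleGraph V :=
  SimpleGraph.fromEdgeSet ((fun e : Edge V => (e : Sym2 V)) '' (F : Set (Edge V)))

/-- `F` is a `1`-tree of the complete graph on `V`, where `r` is the node labelled `1`:
exactly two edges of `F` meet `r`, and the other edges of `F` form a spanning tree on
`V \ {r}`. -/
def IsOneTree (r : V) (F : Finset (Edge V)) : Prop :=
  (F ∩ cut {r}).card = 2 ∧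
    ((graphOf (F \ cut {r})).induce ({r}ᶜ : Set V)).IsTree

/-- The incidence vector `χ^F` of a set `F` of edges. -/
def incidenceVector (F : Finset (Edge V)) : Edge V → ℝ :=
  fun e => if e ∈ F then 1 else 0

end RainbowOneTree

/-!
The `1`-trees through `r` are the bases of a matroid (the graphic matroid away from `r`, plus a
uniform matroid of rank two on the edges at `r`), and the sets containing exactly one edge of each
pair, every edge of value one and no edge of value zero are the bases of a partition matroid. A
half-integer point `x` of the subtour polytope lies in both base polytopes, so the theorem is an
instance of the integrality of matroid intersection. Half-integrality is used only to give all
colour classes of the partition matroid an integral sum.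

The integrality is `mem_convexHull_of_mem_colouredBasePolytope`, for an arbitrary integer-valued
submodular function `ρ`. By Krein-Milman it is enough that extreme points `y` are integral. The
tight sets at `y` form a lattice, whose atoms have integral `y`-sum, and the colour classes have
integral sum too; so none of these sets contains exactly one fractional coordinate. With `f > 0`
fractional coordinates there are at most `f / 2` atoms and at most `f / 2` colour classes among
them, and these at most `f` homogeneous equations are dependent, since both families add up to
the total sum. A nonzero solution is a direction in which `y` can be moved both ways.

Here `ρ = oneTreeRank r`. Its submodularity comes from the dimension formula for the spaces of
functions constant along the edges of a graph, `x(F) ≤ ρ(F)` from the subtour inequalities of the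
components of `F`, and `isOneTree_of_card_le_oneTreeRank` identifies the integral points.
-/

namespace RainbowOneTree

/-! ### Vectors with vanishing fibre sums -/

theorem two_mul_card_image_le {α δ : Type*} [Fintype α] [DecidableEq δ] {h : α → δ}
    (hh : ∀ a, ∃ a', a' ≠ a ∧ h a' = h a) :
    2 * (Finset.univ.image h).card ≤ Fintype.card α := by
  rw [← Finset.card_univ]
  refine Finset.mul_card_image_le_card_of_maps_to (f := h)
    (fun a _ => Finset.mem_image_of_mem h (Finset.mem_univ a)) 2 ?_
  intro b hb
  obtain ⟨a, -, rfl⟩ := Finset.mem_image.1 hb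
  obtain ⟨a', hne, ha'⟩ := hh a
  exact Finset.one_lt_card.2 ⟨a', by simpa using ha', a, by simp, hne⟩

/-- Two fibre partitions of a nonempty finite set without singleton fibres do not separate
vectors: each has at most half as many fibres as there are points, and the two systems of fibre
sums share the relation that both add up to the total sum. -/
theorem exists_ne_zero_fibre_sums_eq_zero {α β γ : Type*} [Fintype α] [Nonempty α]
    [DecidableEq β] [DecidableEq γ] (f : α → β) (g : α → γ)
    (hf : ∀ a, ∃ a', a' ≠ a ∧ f a' = f a) (hg : ∀ a, ∃ a', a' ≠ a ∧ g a' = g a) :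
    ∃ d : α → ℝ, d ≠ 0 ∧ (∀ b, ∑ a with f a = b, d a = 0) ∧ ∀ c, ∑ a with g a = c, d a = 0 := by
  classical
  have hcf := two_mul_card_image_le hf
  have hcg := two_mul_card_image_le hg
  let L : (α → ℝ) →ₗ[ℝ] (Finset.univ.image f → ℝ) × (Finset.univ.image g → ℝ) :=
    LinearMap.prod (LinearMap.pi fun b => ∑ a with f a = b, LinearMap.proj a)
      (LinearMap.pi fun b => ∑ a with g a = b, LinearMap.proj a)
  have hL1 (d : α → ℝ) (b) : (L d).1 b = ∑ a with f a = b.1, d a := by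
    simp [L, LinearMap.prod_apply]
  have hL2 (d : α → ℝ) (b) : (L d).2 b = ∑ a with g a = b.1, d a := by
    simp [L, LinearMap.prod_apply]
  have hsum1 (d : α → ℝ) : ∑ b, (L d).1 b = ∑ a, d a := by
    simp only [hL1]
    rw [Finset.sum_coe_sort (Finset.univ.image f) fun b => ∑ a with f a = b, d a]
    exact Finset.sum_fiberwise_of_maps_to
      (fun a _ => Finset.mem_image_of_mem f (Finset.mem_univ a)) _
  have hsum2 (d : α → ℝ) : ∑ b, (L d).2 b = ∑ a, d a := by
    simp only [hL2]
    rw [Finset.sum_coe_sort (Finset.univ.image g) fun b => ∑ a with g a = b, d a]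
    exact Finset.sum_fiberwise_of_maps_to
      (fun a _ => Finset.mem_image_of_mem g (Finset.mem_univ a)) _
  have hinj : ¬ Function.Injective L := by
    intro hinj
    have hrange : LinearMap.range L = ⊤ := by
      apply Submodule.eq_top_of_finrank_eq
      apply le_antisymm (Submodule.finrank_le _)
      rw [LinearMap.finrank_range_of_inj hinj]
      simp only [Module.finrank_prod, Module.finrank_fintype_fun_eq_card, Fintype.card_coe]
      lia
    -- a vector whose first component sums to a nonzero number and whose second one vanishes
    obtain ⟨d, hd⟩ :
        ((fun _ => 1, 0) : (Finset.univ.image f → ℝ) × (Finset.univ.image g → ℝ)) ∈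
          LinearMap.range L :=
      hrange ▸ Submodule.mem_top
    have h1 := hsum1 d
    have h2 := hsum2 d
    rw [hd] at h1 h2
    rw [← h2] at h1
    simp [Finset.univ_eq_empty_iff] at h1
  rw [← LinearMap.ker_eq_bot, Submodule.eq_bot_iff] at hinj
  push Not at hinj
  obtain ⟨d, hd, hd0⟩ := hinj
  rw [LinearMap.mem_ker] at hd
  refine ⟨d, hd0, fun b => ?_, fun b => ?_⟩
  · by_cases hb : b ∈ Finset.univ.image f
    · rw [← hL1 d ⟨b, hb⟩, hd]; rfl
    · refine Finset.sum_eq_zero fun a ha => (hb ?_).elim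
      exact Finset.mem_image.2 ⟨a, Finset.mem_univ a, (Finset.mem_filter.1 ha).2⟩
  · by_cases hb : b ∈ Finset.univ.image g
    · rw [← hL2 d ⟨b, hb⟩, hd]; rfl
    · refine Finset.sum_eq_zero fun a ha => (hb ?_).elim
      exact Finset.mem_image.2 ⟨a, Finset.mem_univ a, (Finset.mem_filter.1 ha).2⟩

/-! ### Polymatroid base polytopes with prescribed colour sums -/

/-- The constraint `y(S) ≤ ρ(S)` holds with equality at `y`. -/
def IsTight {ι : Type*} (ρ : Finset ι → ℤ) (y : ι → ℝ) (S : Finset ι) : Prop :=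
  ∑ e ∈ S, y e = ρ S

section
variable {ι κ : Type*} [Fintype ι] [DecidableEq κ] {ρ : Finset ι → ℤ} {c : ι → κ} {m : κ → ℤ}

/-- The points of `[0, 1]^ι` in the base polytope of `ρ` (that is, `y(S) ≤ ρ(S)` for all `S`, with
equality for the ground set) whose sum over each colour class `{e | c e = k}` is the prescribed
integer `m k`. -/
def colouredBasePolytope (ρ : Finset ι → ℤ) (c : ι → κ) (m : κ → ℤ) :
    Set (ι → ℝ) :=
  {y | (∀ e, 0 ≤ y e ∧ y e ≤ 1) ∧ (∀ S, ∑ e ∈ S, y e ≤ ρ S) ∧ IsTight ρ y Finset.univ ∧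
    ∀ k, ∑ e with c e = k, y e = m k}

theorem isCompact_colouredBasePolytope : IsCompact (colouredBasePolytope ρ c m) := by
  refine (isCompact_univ_pi fun _ : ι => isCompact_Icc (a := (0 : ℝ)) (b := 1)).of_isClosed_subset
    ?_ fun y hy e _ => hy.1 e
  simp only [colouredBasePolytope, IsTight, Set.ofPred_and, Set.ofPred_forall]
  refine .inter (isClosed_iInter fun e => .inter ?_ ?_) (.inter (isClosed_iInter fun S => ?_)
    (.inter ?_ (isClosed_iInter fun k => ?_)))
  · exact isClosed_le (by fun_prop) (by fun_prop)
  · exact isClosed_le (by fun_prop) (by fun_prop)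
  · exact isClosed_le (by fun_prop) (by fun_prop)
  · exact isClosed_eq (by fun_prop) (by fun_prop)
  · exact isClosed_eq (by fun_prop) (by fun_prop)

theorem convex_colouredBasePolytope : Convex ℝ (colouredBasePolytope ρ c m) := by
  intro y hy z hz a b ha hb hab
  have hs (S : Finset ι) : ∑ e ∈ S, (a • y + b • z) e = a * ∑ e ∈ S, y e + b * ∑ e ∈ S, z e := by
    simp [Finset.sum_add_distrib, Finset.mul_sum]
  obtain ⟨hy1, hy2, hy3, hy4⟩ := hy
  obtain ⟨hz1, hz2, hz3, hz4⟩ := hz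
  refine ⟨fun e => ?_, fun S => ?_, ?_, fun k => ?_⟩
  · exact convex_Icc (0 : ℝ) 1 (hy1 e) (hz1 e) ha hb hab
  · rw [hs]
    exact convex_Iic (ρ S : ℝ) (hy2 S) (hz2 S) ha hb hab
  · rw [IsTight, hs, hy3, hz3, ← add_mul, hab, one_mul]
  · rw [hs, hy4, hz4, ← add_mul, hab, one_mul]

end

section
variable {ι : Type*} [DecidableEq ι] {ρ : Finset ι → ℤ} {y : ι → ℝ}

theorem IsTight.union_and_inter
    (hρ : ∀ S T, ρ (S ∪ T) + ρ (S ∩ T) ≤ ρ S + ρ T) (hy : ∀ S, ∑ e ∈ S, y e ≤ ρ S)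
    {S T : Finset ι} (hS : IsTight ρ y S) (hT : IsTight ρ y T) :
    IsTight ρ y (S ∪ T) ∧ IsTight ρ y (S ∩ T) := by
  have h1 := Finset.sum_union_inter (s₁ := S) (s₂ := T) (f := y)
  have h2 := hy (S ∪ T)
  have h3 := hy (S ∩ T)
  have h4 : (ρ (S ∪ T) + ρ (S ∩ T) : ℝ) ≤ ρ S + ρ T := by exact_mod_cast hρ S T
  unfold IsTight at *
  constructor <;> linarith

/-- The tight sets form a lattice. The set `A` of the elements lying in the same tight sets as `e`
is the difference of two tight sets, one containing the other: the least tight set containing `e`,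
and the union of the least tight sets of those of its elements whose least tight set misses `e`.
So `y(A)` is an integer. -/
theorem exists_int_sum_atom [Fintype ι]
    (hρ : ∀ S T, ρ (S ∪ T) + ρ (S ∩ T) ≤ ρ S + ρ T) (h0 : ρ ∅ = 0)
    (hy : ∀ S, ∑ e ∈ S, y e ≤ ρ S) (huniv : IsTight ρ y Finset.univ) (A : Finset ι) (e : ι)
    (hA : ∀ f, f ∈ A ↔ ∀ T, IsTight ρ y T → (f ∈ T ↔ e ∈ T)) :
    ∃ k : ℤ, ∑ f ∈ A, y f = k := by
  classical
  -- `D f` is the least tight set containing `f`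
  let D : ι → Finset ι := fun f => (Finset.univ.filter fun T => IsTight ρ y T ∧ f ∈ T).inf id
  have hDmem (f g : ι) : g ∈ D f ↔ ∀ T, IsTight ρ y T → f ∈ T → g ∈ T := by
    simp [D, Finset.mem_inf]
  have hD (f : ι) : IsTight ρ y (D f) :=
    Finset.inf_induction (p := IsTight ρ y) huniv
      (fun S hS T hT => (hS.union_and_inter hρ hy hT).2) (by simp +contextual)
  have hDself (f : ι) : f ∈ D f := (hDmem f f).2 fun _ _ h => h
  let U : Finset ι := ((D e).filter fun f => e ∉ D f).sup D
  have hU : IsTight ρ y U :=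
    Finset.sup_induction (p := IsTight ρ y) (by simp [IsTight, h0])
      (fun S hS T hT => (hS.union_and_inter hρ hy hT).1) (fun f _ => hD f)
  have hUD : U ⊆ D e := by
    refine Finset.sup_le fun f hf g hg => ?_
    rw [Finset.mem_filter] at hf
    exact (hDmem f g).1 hg _ (hD e) hf.1
  have hAU : A = D e \ U := by
    ext f
    rw [hA, Finset.mem_sdiff, Finset.mem_sup]
    constructor
    · intro h
      refine ⟨(h _ (hD e)).2 (hDself e), ?_⟩
      rintro ⟨g, hg, hfg⟩
      exact (Finset.mem_filter.1 hg).2 ((h _ (hD g)).1 hfg)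
    · rintro ⟨hfe, hf⟩ T hT
      refine ⟨fun hfT => ?_, fun heT => (hDmem e f).1 hfe T hT heT⟩
      by_contra heT
      exact hf ⟨f, Finset.mem_filter.2 ⟨hfe, fun h => heT ((hDmem f e).1 h T hT hfT)⟩, hDself f⟩
  refine ⟨ρ (D e) - ρ U, ?_⟩
  have := Finset.sum_sdiff (f := y) hUD
  have h1 := hD e
  unfold IsTight at *
  rw [hAU]
  push_cast
  linarith

theorem exists_ne_fractional {A : Finset ι} (hA : ∃ k : ℤ, ∑ f ∈ A, y f = k) {e : ι} (he : e ∈ A)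
    (hye : ¬ ∃ k : ℤ, y e = k) : ∃ f ∈ A, f ≠ e ∧ ¬ ∃ k : ℤ, y f = k := by
  by_contra! h
  choose! m hm using h
  obtain ⟨k, hk⟩ := hA
  refine hye ⟨k - ∑ f ∈ A.erase e, m f, ?_⟩
  have h1 := Finset.add_sum_erase A y he
  have h2 : ∑ f ∈ A.erase e, y f = ∑ f ∈ A.erase e, (m f : ℝ) :=
    Finset.sum_congr rfl fun f hf => hm f (Finset.mem_of_mem_erase hf) (Finset.ne_of_mem_erase hf)
  push_cast
  linarith

variable [Fintype ι] {κ : Type*} [DecidableEq κ] {c : ι → κ} {m : κ → ℤ}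

/-- At a point with a fractional coordinate there is a direction that respects all tight
constraints. The fractional coordinates are partitioned by colour, and also by the tight sets that
contain them. Colour classes and atoms of the lattice of tight sets have integer sums, so no part
is a singleton, and `exists_ne_zero_fibre_sums_eq_zero` applies. -/
theorem exists_direction_of_fractional (hρ : ∀ S T, ρ (S ∪ T) + ρ (S ∩ T) ≤ ρ S + ρ T)
    (h0 : ρ ∅ = 0) (hy : y ∈ colouredBasePolytope ρ c m) (hfrac : ∃ e, ¬ ∃ k : ℤ, y e = k) :
    ∃ d : ι → ℝ, d ≠ 0 ∧ (∀ e, (∃ k : ℤ, y e = k) → d e = 0) ∧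
      (∀ S, IsTight ρ y S → ∑ e ∈ S, d e = 0) ∧ ∀ k, ∑ e with c e = k, d e = 0 := by
  classical
  obtain ⟨-, hle, huniv, hc⟩ := hy
  have : Nonempty {e : ι // ¬ ∃ k : ℤ, y e = k} := ⟨⟨_, hfrac.choose_spec⟩⟩
  -- the fibres of `t` are the atoms of the lattice of tight sets
  let t : ι → Finset (Finset ι) := fun e => Finset.univ.filter fun T => IsTight ρ y T ∧ e ∈ T
  have ht (e f : ι) : t f = t e ↔ ∀ T, IsTight ρ y T → (f ∈ T ↔ e ∈ T) := by
    simp only [t, Finset.ext_iff, Finset.mem_filter, Finset.mem_univ, true_and]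
    grind
  obtain ⟨d, hd, hd1, hd2⟩ := exists_ne_zero_fibre_sums_eq_zero 
    (α := {e : ι // ¬ ∃ k : ℤ, y e = k}) (fun a => c a) (fun a => t a) (fun a => by
      obtain ⟨f, hf, hne, hfr⟩ := exists_ne_fractional (A := Finset.univ.filter fun e => c e = c a)
        ⟨_, hc (c a)⟩ (by simp) a.2
      exact ⟨⟨f, hfr⟩, by simpa [Subtype.ext_iff] using hne, by simpa using hf⟩)
    (fun a => by
      obtain ⟨f, hf, hne, hfr⟩ := exists_ne_fractional (A := Finset.univ.filter fun e => t e = t a)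
        (exists_int_sum_atom hρ h0 hle huniv _ a.1 (by simp [ht])) (by simp) a.2
      exact ⟨⟨f, hfr⟩, by simpa [Subtype.ext_iff] using hne, by simpa using hf⟩)
  -- extend `d` by zero
  let D : ι → ℝ := fun e => if h : ¬ ∃ k : ℤ, y e = k then d ⟨e, h⟩ else 0
  have hDsum (p : ι → Prop) [DecidablePred p] :
      ∑ e with p e, D e =
        ∑ a ∈ Finset.univ.filter fun a : {e : ι // ¬ ∃ k : ℤ, y e = k} => p a.1, d a := by
    rw [Finset.sum_filter, Finset.sum_filter]
    refine (Finset.sum_of_injOn Subtype.val Subtype.val_injective.injOn (by simp) ?_ ?_).symm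
    · intro e _ he
      have : ∃ k : ℤ, y e = k := by simpa using he
      simp [D, this]
    · intro a _
      simp only [D, dif_pos a.2]
  refine ⟨D, fun h => hd ?_, fun e he => dif_neg (not_not.2 he), fun S hS => ?_, fun k => ?_⟩
  · funext a
    have := congrFun h a.1
    simpa only [D, dif_pos a.2, Pi.zero_apply] using this
  · -- a tight set is a disjoint union of atoms
    rw [← Finset.sum_fiberwise_of_maps_to (t := S.image t) (g := t)
      (fun e he => Finset.mem_image_of_mem t he)]
    refine Finset.sum_eq_zero fun b hb => ?_
    obtain ⟨e, he, rfl⟩ := Finset.mem_image.1 hb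
    rw [← hd2 (t e), ← hDsum fun f => t f = t e]
    refine Finset.sum_congr ?_ fun _ _ => rfl
    ext f
    simp only [Finset.mem_filter, Finset.mem_univ, true_and, and_iff_right_iff_imp]
    exact fun h => ((ht e f).1 h S hS).2 he
  · rw [hDsum fun e => c e = k, hd1 k]

open Filter Topology in
theorem isInt_of_mem_extremePoints (hρ : ∀ S T, ρ (S ∪ T) + ρ (S ∩ T) ≤ ρ S + ρ T)
    (h0 : ρ ∅ = 0) (hy : y ∈ (colouredBasePolytope ρ c m).extremePoints ℝ) (e : ι) :
    ∃ k : ℤ, y e = k := by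
  by_contra hfrac
  obtain ⟨d, hd, hdint, hdtight, hdc⟩ := exists_direction_of_fractional hρ h0 hy.1 ⟨e, hfrac⟩
  -- constraints that are not tight at `y` survive a small step in any direction
  have key (a b u : ℝ) (h : a < u ∨ b = 0 ∧ a ≤ u) : ∀ᶠ ε in 𝓝 (0 : ℝ), a + ε * b ≤ u := by
    rcases h with h | ⟨rfl, h⟩
    · have hc : Tendsto (fun ε : ℝ => a + ε * b) (𝓝 0) (𝓝 (a + 0 * b)) :=
        (by fun_prop : Continuous fun ε : ℝ => a + ε * b).tendsto 0
      rw [zero_mul, add_zero] at hc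
      exact (hc.eventually_lt_const h).mono fun _ => le_of_lt
    · simp [h]
  obtain ⟨⟨hbox, hle, huniv, hc⟩, hext⟩ := hy
  have hmem : ∀ᶠ ε in 𝓝 (0 : ℝ), (fun e => y e + ε * d e) ∈ colouredBasePolytope ρ c m := by
    have h1 : ∀ᶠ ε in 𝓝 (0 : ℝ), ∀ e, y e + ε * d e ≤ 1 := by
      refine eventually_all.2 fun e => key _ _ _ ?_
      rcases (hbox e).2.lt_or_eq with h | h
      · exact .inl h
      · exact .inr ⟨hdint e ⟨1, by simp [h]⟩, h.le⟩
    have h2 : ∀ᶠ ε in 𝓝 (0 : ℝ), ∀ e, -y e + ε * -d e ≤ 0 := by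
      refine eventually_all.2 fun e => key _ _ _ ?_
      rcases (hbox e).1.lt_or_eq with h | h
      · exact .inl (by linarith)
      · exact .inr ⟨by rw [hdint e ⟨0, by simp [← h]⟩, neg_zero], by simp [← h]⟩
    have h3 : ∀ᶠ ε in 𝓝 (0 : ℝ), ∀ S, ∑ e ∈ S, y e + ε * ∑ e ∈ S, d e ≤ ρ S := by
      refine eventually_all.2 fun S => key _ _ _ ?_
      rcases (hle S).lt_or_eq with h | h
      · exact .inl h
      · exact .inr ⟨hdtight S h, h.le⟩
    filter_upwards [h1, h2, h3] with ε h1 h2 h3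
    have hs (S : Finset ι) : ∑ e ∈ S, (y e + ε * d e) = ∑ e ∈ S, y e + ε * ∑ e ∈ S, d e := by
      rw [Finset.sum_add_distrib, Finset.mul_sum]
    refine ⟨fun e => ⟨by linarith [h2 e], h1 e⟩, fun S => by rw [hs]; exact h3 S, ?_, fun k => ?_⟩
    · rw [IsTight, hs, hdtight _ huniv, mul_zero, add_zero]
      exact huniv
    · rw [hs, hdc, mul_zero, add_zero, hc]
  have hneg : ∀ᶠ ε in 𝓝 (0 : ℝ), (fun e => y e + -ε * d e) ∈ colouredBasePolytope ρ c m :=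
    (by simpa using tendsto_neg (0 : ℝ) : Tendsto (fun ε : ℝ => -ε) (𝓝 0) (𝓝 0)).eventually hmem
  obtain ⟨ε, ⟨hp, hn⟩, hε⟩ := (((hmem.and hneg).filter_mono nhdsWithin_le_nhds).and
    (self_mem_nhdsWithin : ∀ᶠ ε in 𝓝[>] (0 : ℝ), ε ∈ Set.Ioi 0)).exists
  have := hext hp hn ⟨1 / 2, 1 / 2, by norm_num, by norm_num, by norm_num, by
    funext e; simp only [Pi.add_apply, Pi.smul_apply, smul_eq_mul]; ring⟩
  refine hd (funext fun e => ?_)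
  have h := congrFun this e
  simpa [(show (0 : ℝ) < ε from hε).ne'] using h

/-- Integrality of the intersection of a polymatroid base polytope with the base polytope of a
partition matroid: each of its points is a convex combination of its `0`-`1` points. -/
theorem mem_convexHull_of_mem_colouredBasePolytope (hρ : ∀ S T, ρ (S ∪ T) + ρ (S ∩ T) ≤ ρ S + ρ T)
    (h0 : ρ ∅ = 0) (hy : y ∈ colouredBasePolytope ρ c m) :
    y ∈ convexHull ℝ {z | z ∈ colouredBasePolytope ρ c m ∧
      ∃ F : Finset ι, z = fun e => if e ∈ F then 1 else 0} := by
  classical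
  set A := {z | z ∈ colouredBasePolytope ρ c m ∧
    ∃ F : Finset ι, z = fun e => if e ∈ F then (1 : ℝ) else 0}
  have hfin : A.Finite :=
    (Set.finite_range fun (F : Finset ι) e => if e ∈ F then (1 : ℝ) else 0).subset
      fun z hz => hz.2.imp fun F hF => hF.symm
  -- Krein-Milman; the closure is harmless since there are finitely many `0`-`1` points
  rw [← closure_convexHull_extremePoints isCompact_colouredBasePolytope
    convex_colouredBasePolytope] at hy
  refine closure_minimal (convexHull_mono fun z hz => ?_) (hfin.isClosed_convexHull ℝ) hy
  refine ⟨hz.1, Finset.univ.filter fun e => z e = 1, ?_⟩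
  funext e
  obtain ⟨k, hk⟩ := isInt_of_mem_extremePoints hρ h0 hz e
  have h1 : (0 : ℝ) ≤ k := hk ▸ (hz.1.1 e).1
  have h2 : (k : ℝ) ≤ 1 := hk ▸ (hz.1.1 e).2
  have h3 : 0 ≤ k := by exact_mod_cast h1
  have h4 : k ≤ 1 := by exact_mod_cast h2
  obtain rfl | rfl : k = 0 ∨ k = 1 := by lia
  · simp [hk]
  · simp [hk]

end

/-! ### Counting connected components -/

section
variable {V : Type*} [Fintype V]

/-- The number of connected components is the dimension of the space of functions that are
constant along the edges. For `G ⊔ H` this space is the intersection of those for `G` and `H`, and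
for `L` it contains their sum, so the claim is the dimension formula. -/
theorem card_connectedComponent_add_le (G H L : SimpleGraph V) (hG : L ≤ G) (hH : L ≤ H) :
    Nat.card G.ConnectedComponent + Nat.card H.ConnectedComponent ≤
      Nat.card (G ⊔ H).ConnectedComponent + Nat.card L.ConnectedComponent := by
  classical
  let K (G : SimpleGraph V) : Submodule ℝ (V → ℝ) := (G.lapMatrix ℝ).toLin'.ker
  have hK (G : SimpleGraph V) (f : V → ℝ) : f ∈ K G ↔ ∀ u v, G.Adj u v → f u = f v := by
    rw [← G.lapMatrix_mulVec_eq_zero_iff_forall_adj, LinearMap.mem_ker, Matrix.toLin'_apply]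
  have hcard (G : SimpleGraph V) : Nat.card G.ConnectedComponent = Module.finrank ℝ (K G) := by
    rw [Nat.card_eq_fintype_card, G.card_connectedComponent_eq_finrank_ker_toLin'_lapMatrix]
  simp only [hcard]
  rw [← Submodule.finrank_sup_add_finrank_inf_eq, add_comm]
  refine add_le_add (Submodule.finrank_mono fun f hf => ?_) (Submodule.finrank_mono ?_)
  · rw [Submodule.mem_inf, hK, hK] at hf
    rw [hK]
    rintro u v (h | h)
    exacts [hf.1 u v h, hf.2 u v h]
  · refine sup_le (fun f hf => ?_) fun f hf => ?_ <;> rw [hK] at hf ⊢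
    exacts [fun u v h => hf u v (hG h), fun u v h => hf u v (hH h)]

end

/-! ### Cuts and the graph of an edge set -/

section
variable {V : Type*}

theorem graphOf_adj {F : Finset (Edge V)} {u v : V} :
    (graphOf F).Adj u v ↔ ∃ e ∈ F, e.1 = s(u, v) := by
  rw [graphOf, SimpleGraph.fromEdgeSet_adj]
  constructor
  · rintro ⟨⟨e, he, h⟩, -⟩
    exact ⟨e, he, h⟩
  · rintro ⟨e, he, h⟩
    have := e.2
    rw [h] at this
    exact ⟨⟨e, he, h⟩, by simpa using this⟩

theorem graphOf_mono {F H : Finset (Edge V)} (h : F ⊆ H) : graphOf F ≤ graphOf H := by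
  intro u v
  simp only [graphOf_adj]
  exact fun ⟨e, he, h'⟩ => ⟨e, h he, h'⟩

theorem graphOf_union [DecidableEq V] (F H : Finset (Edge V)) :
    graphOf (F ∪ H) = graphOf F ⊔ graphOf H := by
  ext u v
  simp only [graphOf_adj, SimpleGraph.sup_adj, Finset.mem_union]
  grind

theorem Edge.exists_eq (e : Edge V) : ∃ u v, u ≠ v ∧ e.1 = s(u, v) := by
  obtain ⟨e, he⟩ := e
  induction e using Sym2.ind with
  | h u v => exact ⟨u, v, by simpa using he, rfl⟩

variable [Fintype V] [DecidableEq V]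

theorem mem_cut_iff {e : Edge V} {u v : V} (h : e.1 = s(u, v)) (S : Finset V) :
    e ∈ cut S ↔ u ∈ S ∧ v ∉ S ∨ v ∈ S ∧ u ∉ S := by
  simp only [cut, Finset.mem_filter, Finset.mem_univ, true_and, h, Sym2.eq_iff]
  grind

theorem mem_cut_singleton {e : Edge V} {w : V} : e ∈ cut {w} ↔ w ∈ e.1 := by
  obtain ⟨u, v, huv, h⟩ := e.exists_eq
  rw [mem_cut_iff h, h, Sym2.mem_iff]
  simp only [Finset.mem_singleton]
  grind

/-- The edges of the complete graph with both ends in `S`. -/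
def inside (S : Finset V) : Finset (Edge V) :=
  Finset.univ.filter fun e => ∀ v ∈ e.1, v ∈ S

theorem mem_inside_iff {e : Edge V} {u v : V} (h : e.1 = s(u, v)) (S : Finset V) :
    e ∈ inside S ↔ u ∈ S ∧ v ∈ S := by
  simp [inside, h]

/-- In the degree sum over `S`, edges inside `S` count twice and edges of the cut once. -/
theorem sum_sum_cut_singleton (x : Edge V → ℝ) (S : Finset V) :
    ∑ v ∈ S, ∑ e ∈ cut {v}, x e = 2 * ∑ e ∈ inside S, x e + ∑ e ∈ cut S, x e := by
  classical
  have h1 (v : V) : ∑ e ∈ cut {v}, x e = ∑ e, if v ∈ e.1 then x e else 0 := by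
    rw [← Finset.sum_filter]
    exact Finset.sum_congr (by ext e; simp [mem_cut_singleton]) fun _ _ => rfl
  simp only [h1]
  rw [Finset.sum_comm, ← Finset.univ_inter (inside S), ← Finset.univ_inter (cut S),
    ← Finset.sum_ite_mem, ← Finset.sum_ite_mem, Finset.mul_sum, ← Finset.sum_add_distrib]
  refine Finset.sum_congr rfl fun e _ => ?_
  obtain ⟨u, v, huv, h⟩ := e.exists_eq
  have h2 (w : V) : (if w ∈ e.1 then x e else 0) =
      (if w = u then x e else 0) + if w = v then x e else 0 := by
    simp only [h, Sym2.mem_iff]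
    split_ifs <;> grind
  simp only [h2, Finset.sum_add_distrib, Finset.sum_ite_eq', mem_inside_iff h, mem_cut_iff h]
  by_cases hu : u ∈ S <;> by_cases hv : v ∈ S <;> simp [hu, hv, two_mul]

/-! ### The subtour polytope and the rank function of the `1`-trees -/

variable {x : Edge V → ℝ}

theorem sum_inside_le (hx : x ∈ subtourPolytope V) {S : Finset V} (h : S ≠ ∅)
    (h' : S ≠ Finset.univ) : ∑ e ∈ inside S, x e ≤ S.card - 1 := by
  have h1 := sum_sum_cut_singleton x S
  rw [Finset.sum_congr rfl fun v _ => hx.1 v, Finset.sum_const, nsmul_eq_mul] at h1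
  linarith [hx.2.1 S h h']

theorem sum_univ_eq_card (hx : x ∈ subtourPolytope V) : ∑ e, x e = Fintype.card V := by
  have h1 := sum_sum_cut_singleton x Finset.univ
  rw [Finset.sum_congr rfl fun v _ => hx.1 v, Finset.sum_const, nsmul_eq_mul,
    Finset.card_univ] at h1
  have h2 : inside (Finset.univ : Finset V) = Finset.univ := by simp [inside]
  have h3 : cut (Finset.univ : Finset V) = ∅ := by simp [cut]
  rw [h2, h3, Finset.sum_empty] at h1
  linarith

/-- On a single node the degree constraint would read `0 = 2`. -/
theorem exists_ne_of_mem_subtourPolytope (hx : x ∈ subtourPolytope V) (r : V) : ∃ v, v ≠ r := by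
  have h : (cut {r} : Finset (Edge V)).Nonempty := by
    by_contra h
    have := hx.1 r
    rw [Finset.not_nonempty_iff_eq_empty.1 h] at this
    simp at this
  obtain ⟨e, he⟩ := h
  simp only [cut, Finset.mem_filter] at he
  obtain ⟨-, u, hu, v, hv, -⟩ := he
  exact ⟨v, by simpa using hv⟩

/-- `r` is isolated in a graph without edges at `r`. -/
theorem eq_of_reachable {F : Finset (Edge V)} {r v : V} (hF : Disjoint F (cut {r}))
    (h : (graphOf F).Reachable r v) : v = r := by
  obtain ⟨p⟩ := h
  cases p with
  | nil => rfl
  | cons h' _ =>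
    obtain ⟨e, he, hr⟩ := graphOf_adj.1 h'
    exact absurd (mem_cut_singleton.2 (by simp [hr])) (Finset.disjoint_left.1 hF he)

/-- Sum `x(E(C)) ≤ |C| - 1` over the components `C` of `(V, F)`; the inequality is available since
no component is all of `V`, as `r` is isolated. -/
theorem sum_le_card_sub_card_connectedComponent (hx : x ∈ subtourPolytope V) (r : V)
    {F : Finset (Edge V)} (hF : Disjoint F (cut {r})) :
    ∑ e ∈ F, x e ≤ Fintype.card V - Nat.card (graphOf F).ConnectedComponent := by
  classical
  let G := graphOf F
  let S (C : G.ConnectedComponent) : Finset V :=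
    Finset.univ.filter fun v => G.connectedComponentMk v = C
  have hS (C : G.ConnectedComponent) : ∑ e ∈ inside (S C), x e ≤ (S C).card - 1 := by
    obtain ⟨w, hw⟩ := exists_ne_of_mem_subtourPolytope hx r
    refine sum_inside_le hx ?_ fun h => hw ?_
    · induction C using SimpleGraph.ConnectedComponent.ind with
      | h v => exact Finset.ne_empty_of_mem (a := v) (by simp [S])
    · have h1 (v : V) : G.connectedComponentMk v = C := by
        have := Finset.mem_univ v
        rw [← h] at this
        simpa [S] using this
      exact eq_of_reachable hF (SimpleGraph.ConnectedComponent.eq.1 ((h1 r).trans (h1 w).symm))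
  calc ∑ e ∈ F, x e ≤ ∑ e ∈ Finset.univ.biUnion fun C => inside (S C), x e := by
        refine Finset.sum_le_sum_of_subset_of_nonneg (fun e he => ?_) fun e _ _ => (hx.2.2 e).1
        obtain ⟨u, v, huv, h⟩ := e.exists_eq
        refine Finset.mem_biUnion.2 ⟨G.connectedComponentMk u, Finset.mem_univ _, ?_⟩
        rw [mem_inside_iff h]
        have : G.Adj u v := graphOf_adj.2 ⟨e, he, h⟩
        simpa [S] using this.symm.reachable
    _ = ∑ C, ∑ e ∈ inside (S C), x e := by
        refine Finset.sum_biUnion fun C _ C' _ hne => Finset.disjoint_left.2 fun e he he' => hne ?_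
        obtain ⟨u, v, huv, h⟩ := e.exists_eq
        rw [mem_inside_iff h] at he he'
        simp only [S, Finset.mem_filter] at he he'
        exact he.1.2.symm.trans he'.1.2
    _ ≤ ∑ C, (((S C).card : ℝ) - 1) := Finset.sum_le_sum fun C _ => hS C
    _ = _ := by
      rw [Finset.sum_sub_distrib, ← Nat.cast_sum, ← Finset.card_eq_sum_card_fiberwise
        (f := G.connectedComponentMk) (s := Finset.univ) (fun _ _ => Finset.mem_univ _)]
      simp [G, Nat.card_eq_fintype_card]

/-- A submodular function whose `0`-`1` bases are the `1`-trees: the graphic rank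
`|V| - #components` of the edges of `F` not at `r`, plus a bound for the edges at `r`. That bound
is `2` as soon as `F` contains an edge at `r`; the matroid rank `min 2 |F ∩ δ(r)|` is not needed,
because of the bounds `0 ≤ y e ≤ 1`. -/
noncomputable def oneTreeRank (r : V) (F : Finset (Edge V)) : ℤ :=
  Fintype.card V - Nat.card (graphOf (F \ cut {r})).ConnectedComponent +
    if (F ∩ cut {r}).Nonempty then 2 else 0

theorem oneTreeRank_empty (r : V) : oneTreeRank r ∅ = 0 := by
  classical
  have h : graphOf (∅ : Finset (Edge V)) = ⊥ := by
    ext u v; simp [graphOf_adj]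
  have hb : Function.Bijective (⊥ : SimpleGraph V).connectedComponentMk :=
    ⟨fun u v huv => SimpleGraph.reachable_bot.1 (SimpleGraph.ConnectedComponent.eq.1 huv),
      fun C => C.exists_rep⟩
  simp only [oneTreeRank, Finset.empty_sdiff, Finset.empty_inter, h,
    ← Nat.card_eq_of_bijective _ hb]
  simp [Nat.card_eq_fintype_card]

theorem oneTreeRank_submodular (r : V) (S T : Finset (Edge V)) :
    oneTreeRank r (S ∪ T) + oneTreeRank r (S ∩ T) ≤ oneTreeRank r S + oneTreeRank r T := by
  have h := card_connectedComponent_add_le (graphOf (S \ cut {r})) (graphOf (T \ cut {r}))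
    (graphOf ((S ∩ T) \ cut {r})) (graphOf_mono (by grind)) (graphOf_mono (by grind))
  rw [← graphOf_union, ← Finset.union_sdiff_distrib] at h
  simp only [oneTreeRank, Finset.Nonempty, Finset.mem_inter, Finset.mem_union]
  split_ifs <;> grind

theorem sum_le_oneTreeRank (hx : x ∈ subtourPolytope V) (r : V) (F : Finset (Edge V)) :
    ∑ e ∈ F, x e ≤ oneTreeRank r F := by
  have h1 := sum_le_card_sub_card_connectedComponent hx r
    (F := F \ cut {r}) Finset.sdiff_disjoint
  rw [← Finset.sum_inter_add_sum_sdiff F (cut {r}) x, oneTreeRank]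
  push_cast
  have h2 : ∑ e ∈ F ∩ cut {r}, x e ≤ if (F ∩ cut {r}).Nonempty then 2 else 0 := by
    split_ifs with h
    · rw [← hx.1 r]
      exact Finset.sum_le_sum_of_subset_of_nonneg Finset.inter_subset_right
        fun e _ _ => (hx.2.2 e).1
    · rw [Finset.not_nonempty_iff_eq_empty.1 h, Finset.sum_empty]
  linarith

theorem two_le_card_connectedComponent {r w : V} (hw : w ≠ r) {F : Finset (Edge V)}
    (hF : Disjoint F (cut {r})) : 2 ≤ Nat.card (graphOf F).ConnectedComponent := by
  classical
  rw [Nat.card_eq_fintype_card]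
  refine Fintype.one_lt_card_iff.2 ⟨_, _, fun h => hw (eq_of_reachable hF
    (SimpleGraph.ConnectedComponent.eq.1 h))⟩

theorem sum_univ_eq_oneTreeRank (hx : x ∈ subtourPolytope V) (r : V) :
    ∑ e, x e = oneTreeRank r (Finset.univ : Finset (Edge V)) := by
  obtain ⟨w, hw⟩ := exists_ne_of_mem_subtourPolytope hx r
  refine le_antisymm (sum_le_oneTreeRank hx r _) ?_
  have h := two_le_card_connectedComponent hw (F := Finset.univ \ cut {r}) Finset.sdiff_disjoint
  have h' : oneTreeRank r (Finset.univ : Finset (Edge V)) ≤ Fintype.card V := by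
    unfold oneTreeRank
    split_ifs <;> lia
  rw [sum_univ_eq_card hx]
  exact_mod_cast h'

/-- The rank bounds force two edges at `r` and `|V| - 2` others, and the latter leave at most the
two components `{r}` and `V \ {r}`. A connected graph on `|V| - 1` nodes with `|V| - 2` edges is a
tree. -/
theorem isOneTree_of_card_le_oneTreeRank {r w : V} (hw : w ≠ r) {F : Finset (Edge V)}
    (hle : ∀ S, (F ∩ S).card ≤ oneTreeRank r S) (hcard : F.card = Fintype.card V) :
    IsOneTree r F := by
  classical
  have hinter : (F ∩ cut {r}).card ≤ 2 := by
    have h1 := hle (cut {r})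
    have h3 := oneTreeRank_empty r
    simp only [oneTreeRank, Finset.sdiff_self, Finset.inter_self] at h1
    simp only [oneTreeRank, Finset.empty_sdiff, Finset.empty_inter] at h3
    split_ifs at h1 h3 <;> simp_all
  set G := graphOf (F \ cut {r})
  have hdisj : Disjoint (F \ cut {r}) (cut {r}) := Finset.sdiff_disjoint
  have hcomp : (F \ cut {r}).card ≤ Fintype.card V - (Nat.card G.ConnectedComponent : ℤ) := by
    have := hle (F \ cut {r})
    rw [Finset.inter_eq_right.2 Finset.sdiff_subset, oneTreeRank, Finset.sdiff_idem,
      Finset.sdiff_inter_self] at this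
    simpa using this
  have h2 := two_le_card_connectedComponent hw hdisj
  have hsum := Finset.card_inter_add_card_sdiff F (cut {r})
  have hcut : (F ∩ cut {r}).card = 2 := by lia
  have hc2 : Nat.card G.ConnectedComponent = 2 := by lia
  refine ⟨hcut, SimpleGraph.isTree_iff_connected_and_card.2 ⟨?_, ?_⟩⟩
  · have : Nonempty ({r}ᶜ : Set V) := ⟨⟨w, hw⟩⟩
    rw [SimpleGraph.connected_iff]
    refine ⟨fun u v => ?_, this⟩
    have huv : G.Reachable u v := by
      by_contra hne
      have : 2 < Fintype.card G.ConnectedComponent :=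
        Fintype.two_lt_card_iff.2 ⟨G.connectedComponentMk r, G.connectedComponentMk u,
          G.connectedComponentMk v,
          fun h => u.2 (eq_of_reachable hdisj (SimpleGraph.ConnectedComponent.eq.1 h)),
          fun h => v.2 (eq_of_reachable hdisj (SimpleGraph.ConnectedComponent.eq.1 h)),
          fun h => hne (SimpleGraph.ConnectedComponent.eq.1 h)⟩
      rw [← Nat.card_eq_fintype_card] at this
      lia
    obtain ⟨p⟩ := huv
    refine ⟨p.induce {r}ᶜ fun z hz hzr => u.2 ?_⟩
    rw [Set.mem_singleton_iff] at hzr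
    subst hzr
    exact eq_of_reachable hdisj (p.takeUntil z hz).reachable.symm
  · have h1 : Nat.card ((graphOf (F \ cut {r})).induce ({r}ᶜ : Set V)).edgeSet
        = (F \ cut {r}).card := by
      rw [← Set.ncard_coe_finset, ← Set.ncard_image_of_injective _ Subtype.val_injective,
        Nat.card_coe_set_eq, ← Set.ncard_image_of_injective _
          (Sym2.map.injective (Subtype.val_injective (p := fun v => v ∈ ({r}ᶜ : Set V))))]
      congr 1
      ext e
      simp only [Set.mem_image, Finset.mem_coe]
      constructor
      · rintro ⟨e, he, rfl⟩
        induction e using Sym2.ind with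
        | h u v => exact graphOf_adj.1 he
      · rintro ⟨e, he, rfl⟩
        obtain ⟨u, v, huv, h⟩ := Edge.exists_eq e
        have hr := mt mem_cut_singleton.2 (Finset.mem_sdiff.1 he).2
        rw [h, Sym2.mem_iff, not_or] at hr
        exact ⟨s(⟨u, fun h => hr.1 h.symm⟩, ⟨v, fun h => hr.2 h.symm⟩), graphOf_adj.2 ⟨e, he, h⟩,
          h.symm⟩
    have h3 : Nat.card ({r}ᶜ : Set V) = Fintype.card V - 1 := by
      rw [Nat.card_eq_fintype_card, Fintype.card_compl_set]
      simp
    have : 0 < Fintype.card V := Fintype.card_pos_iff.2 ⟨r⟩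
    rw [h1, h3]
    lia

end

end RainbowOneTree

theorem theorem5 (n : ℕ) (r : Fin n) (x : RainbowOneTree.Edge (Fin n) → ℝ)
    (hx : x ∈ RainbowOneTree.subtourPolytope (Fin n))
    (hhalf : RainbowOneTree.IsHalfInteger x)
    (P : Finpartition (RainbowOneTree.halfEdges x))
    (hP : ∀ p ∈ P.parts, p.card = 2) :
    x ∈ convexHull ℝ
      {y : RainbowOneTree.Edge (Fin n) → ℝ |
        ∃ F : Finset (RainbowOneTree.Edge (Fin n)),
          RainbowOneTree.IsOneTree r F ∧ (∀ p ∈ P.parts, (F ∩ p).card = 1) ∧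
            y = RainbowOneTree.incidenceVector F} := by
  classical
  -- the colour classes are the pairs in `P` and the singletons of the edges with integral value
  let c (e : RainbowOneTree.Edge (Fin n)) :
      Finset (RainbowOneTree.Edge (Fin n)) ⊕ RainbowOneTree.Edge (Fin n) :=
    if e ∈ RainbowOneTree.halfEdges x then .inl (P.part e) else .inr e
  let m : Finset (RainbowOneTree.Edge (Fin n)) ⊕ RainbowOneTree.Edge (Fin n) → ℤ :=
    Sum.elim (fun p => if p ∈ P.parts then 1 else 0) fun e => if x e = 1 then 1 else 0
  have hmem (e) : e ∈ RainbowOneTree.halfEdges x ↔ x e = 1 / 2 := by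
    simp [RainbowOneTree.halfEdges]
  have hcinl {p} (hp : p ∈ P.parts) : Finset.univ.filter (fun e => c e = .inl p) = p := by
    ext e
    simp only [c, Finset.mem_filter, Finset.mem_univ, true_and]
    split_ifs with he
    · rw [Sum.inl.injEq, P.part_eq_iff_mem hp]
    · simpa using fun h => he (P.le hp h)
  have hsum (k) : ∑ e with c e = k, x e = m k := by
    rcases k with p | e
    · by_cases hp : p ∈ P.parts
      · rw [hcinl hp, Finset.sum_congr rfl fun e he => (hmem e).1 (P.le hp he), Finset.sum_const,
          hP p hp]
        simp [m, hp]
      · simp only [m, Sum.elim_inl, if_neg hp, Int.cast_zero]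
        refine Finset.sum_eq_zero fun e he => absurd ?_ hp
        simp only [c, Finset.mem_filter, Finset.mem_univ, true_and] at he
        split_ifs at he with h
        exact Sum.inl.inj he ▸ P.part_mem.2 h
    · by_cases he : e ∈ RainbowOneTree.halfEdges x
      · have h1 : Finset.univ.filter (fun f => c f = .inr e) = ∅ := by
          refine Finset.filter_eq_empty_iff.2 fun f _ hf => ?_
          simp only [c] at hf
          split_ifs at hf with h
          exact h (Sum.inr.inj hf ▸ he)
        rw [h1, Finset.sum_empty]
        norm_num [m, (hmem e).1 he]
      · have h1 : Finset.univ.filter (fun f => c f = .inr e) = {e} := by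
          ext f
          simp only [c, Finset.mem_filter, Finset.mem_univ, true_and, Finset.mem_singleton]
          split_ifs with h
          · simpa using fun hfe : f = e => he (hfe ▸ h)
          · simp
        rw [h1, Finset.sum_singleton]
        rcases hhalf e with h | h | h
        · simp [m, h]
        · exact absurd ((hmem e).2 h) he
        · simp [m, h]
  obtain ⟨w, hw⟩ := RainbowOneTree.exists_ne_of_mem_subtourPolytope hx r
  refine convexHull_mono ?_ (RainbowOneTree.mem_convexHull_of_mem_colouredBasePolytope
    (c := c) (m := m)
    (RainbowOneTree.oneTreeRank_submodular r) (RainbowOneTree.oneTreeRank_empty r)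
    ⟨hx.2.2, RainbowOneTree.sum_le_oneTreeRank hx r,
      RainbowOneTree.sum_univ_eq_oneTreeRank hx r, hsum⟩)
  rintro _ ⟨⟨-, hle, huniv, hcol⟩, F, rfl⟩
  have hcard (S : Finset (RainbowOneTree.Edge (Fin n))) :
      ∑ e ∈ S, (if e ∈ F then (1 : ℝ) else 0) = (F ∩ S).card := by
    rw [Finset.sum_boole, Finset.filter_mem_eq_inter, Finset.inter_comm]
  simp only [hcard, RainbowOneTree.IsTight] at hle huniv hcol
  refine ⟨F, RainbowOneTree.isOneTree_of_card_le_oneTreeRank hw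
    (fun S => by exact_mod_cast hle S) ?_,
    fun p hp => ?_, by funext e; simp [RainbowOneTree.incidenceVector]⟩
  · have h1 := RainbowOneTree.sum_univ_eq_card hx
    rw [RainbowOneTree.sum_univ_eq_oneTreeRank hx r, ← huniv, Finset.inter_univ] at h1
    exact_mod_cast h1
  · have h := hcol (.inl p)
    rw [hcinl hp] at h
    simp only [m, Sum.elim_inl, if_pos hp] at h
    exact_mod_cast h
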